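/- Let $d\ge 0$ be an integer and let $U$ be a random matrix distributed according to the normalised Haar (probability) measure on the unitary group $\mathrm U(d)$ of complex unitary $d\times d$ matrices (for $d=0$ this is the trivial group, and $\operatorname{Tr}U=0$). Then, for every integer $k\ge 0$ (with the convention $0^0=1$), the random variable $|\operatorname{Tr}U|^{2k}$ is integrable and $$\mathbb E\bigl[|\operatorname{Tr}U|^{2k}\bigr]\le k!,$$ with equality if $k\le d$. Moreover, $|\operatorname{Tr}U|^2$ has subexponential tails: for every real $t\ge 0$, $$\mathbb P\bigl[|\operatorname{Tr}U|^2\ge t\bigr]\le e^{-\kappa t+2},\qquad \kappa=1-\frac1{2e}.$$ -/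

import Mathlib

open MeasureTheory

/-- The Borel sigma-algebra on the unitary group `U(d)`, for its topology as a subspace of the
complex `d × d` matrices. -/
noncomputable instance unitaryGroupMeasurableSpace (d : ℕ) :
    MeasurableSpace (Matrix.unitaryGroup (Fin d) ℂ) :=
  borel (Matrix.unitaryGroup (Fin d) ℂ)

instance unitaryGroupBorelSpace (d : ℕ) : BorelSpace (Matrix.unitaryGroup (Fin d) ℂ) :=
  ⟨rfl⟩

/-- The unitary group `U(d)` is compact. -/
instance unitaryGroupCompactSpace (d : ℕ) : CompactSpace (Matrix.unitaryGroup (Fin d) ℂ) := by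
  refine isCompact_iff_compactSpace.mp ?_
  have hK : IsCompact (Set.univ.pi fun _ : Fin d => Set.univ.pi fun _ : Fin d =>
      Metric.closedBall (0 : ℂ) 1) :=
    isCompact_univ_pi fun _ => isCompact_univ_pi fun _ => isCompact_closedBall 0 1
  refine IsCompact.of_isClosed_subset (X := Matrix (Fin d) (Fin d) ℂ) hK isClosed_unitary ?_
  intro U hU i _ j _
  simpa using entry_norm_bound_of_unitary hU i j

/-- The Haar measure on `U(d)`, normalised so that the whole group has mass one. -/
noncomputable def haarUnitary (d : ℕ) : Measure (Matrix.unitaryGroup (Fin d) ℂ) :=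
  Measure.haarMeasure ⊤

/-- The normalised Haar measure on `U(d)` is a probability measure. -/
instance haarUnitary_isProbabilityMeasure (d : ℕ) : IsProbabilityMeasure (haarUnitary d) :=
  ⟨by simpa [haarUnitary] using
    Measure.haarMeasure_self (K₀ := (⊤ : TopologicalSpace.PositiveCompacts
      (Matrix.unitaryGroup (Fin d) ℂ)))⟩

/-- The measure `haarUnitary d` is a Haar measure in Mathlib's sense. -/
instance haarUnitary_isHaarMeasure (d : ℕ) : (haarUnitary d).IsHaarMeasure := by
  unfold haarUnitary
  infer_instance

/-! Write V for the space of k-tensors over ℂ^d. The character of `U(d)` acting on End(V) by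
conjugation is |Tr U|^(2k), so its Haar integral is the dimension of the invariants, i.e. of the
commutant of the operators U^⊗k. By Schur–Weyl duality (`mem_span_permTensor_of_commute`) the k!
permutations of the tensor factors span this commutant, and they are independent once k ≤ d: this
gives the bound and the equality.

For the duality, a matrix commuting with every U^⊗k is shown to commute with H^⊗k for Hermitian H,
then by polarisation with all symmetrised tensors, hence with every permutation-invariant matrix. It
thus lies in the double commutant of the group algebra of the permutations, and Jacobson density
puts it in the image of that algebra.

The tail is a Chernoff bound: the moments of |Tr U|² are at most those of an exponential variable.
-/

/-! ### Haar averaging and dimensions of invariants -/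

section Averaging

variable {G E : Type*} [Group G] [TopologicalSpace G] [IsTopologicalGroup G] [CompactSpace G]
  [MeasurableSpace G] [BorelSpace G] [NormedAddCommGroup E] [NormedSpace ℂ E]
  [FiniteDimensional ℂ E]

/-- A continuous function on a compact space is integrable for a finite measure. -/
theorem Continuous.integrable_of_compactSpace {X F : Type*} [TopologicalSpace X] [CompactSpace X]
    [MeasurableSpace X] [BorelSpace X] [NormedAddCommGroup F] [SecondCountableTopologyEither X F]
    (μ : Measure X) [IsFiniteMeasure μ] {f : X → F} (hf : Continuous f) : Integrable f μ :=
  integrableOn_univ.mp (hf.continuousOn.integrableOn_compact' isCompact_univ .univ)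

/-- The average of a continuous representation of a compact group over a probability measure. -/
noncomputable def Representation.haarAverage (ρ : Representation ℂ G E) (μ : Measure G)
    [IsProbabilityMeasure μ] (hρ : ∀ v, Continuous fun g => ρ g v) : E →ₗ[ℂ] E where
  toFun v := ∫ g, ρ g v ∂μ
  map_add' v w := by
    simp only [map_add]
    exact integral_add ((hρ v).integrable_of_compactSpace μ) ((hρ w).integrable_of_compactSpace μ)
  map_smul' c v := by
    simp only [map_smul, RingHom.id_apply]
    exact integral_smul c _

/-- Left invariance of the measure makes every average invariant; total mass one makes invariant
vectors fixed. -/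
theorem Representation.isProj_haarAverage (ρ : Representation ℂ G E) (μ : Measure G)
    [IsProbabilityMeasure μ] [μ.IsMulLeftInvariant] (hρ : ∀ v, Continuous fun g => ρ g v) :
    LinearMap.IsProj ρ.invariants (ρ.haarAverage μ hρ) where
  map_mem v := by
    rw [Representation.mem_invariants]
    intro h
    change ρ h (∫ g, ρ g v ∂μ) = ∫ g, ρ g v ∂μ
    have h1 := (LinearMap.toContinuousLinearMap (ρ h)).integral_comp_comm
      ((hρ v).integrable_of_compactSpace μ)
    simp only [LinearMap.coe_toContinuousLinearMap'] at h1
    rw [← h1, ← integral_mul_left_eq_self (fun g => ρ g v) h]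
    simp
  map_id v hv := by
    change ∫ g, ρ g v ∂μ = v
    rw [Representation.mem_invariants] at hv
    simp [hv]

/-- The integral of the character of a representation of a compact group is the dimension of the
space of invariants. -/
theorem Representation.integral_trace_eq_finrank_invariants (ρ : Representation ℂ G E)
    (μ : Measure G) [IsProbabilityMeasure μ] [μ.IsMulLeftInvariant]
    (hρ : ∀ v, Continuous fun g => ρ g v) :
    ∫ g, LinearMap.trace ℂ E (ρ g) ∂μ = Module.finrank ℂ ρ.invariants := by
  -- The trace of a projection is the dimension of its range; it remains to exchange trace and
  -- integral.
  rw [← (ρ.isProj_haarAverage μ hρ).trace]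
  let b := Module.finBasis ℂ E
  simp_rw [LinearMap.trace_eq_matrix_trace ℂ b, Matrix.trace, Matrix.diag,
    LinearMap.toMatrix_apply]
  rw [integral_finsetSum]
  · refine Finset.sum_congr rfl fun i _ => ?_
    exact (LinearMap.toContinuousLinearMap (b.coord i)).integral_comp_comm
      ((hρ (b i)).integrable_of_compactSpace μ)
  · intro i _
    exact (LinearMap.toContinuousLinearMap (b.coord i)).integrable_comp
      ((hρ (b i)).integrable_of_compactSpace μ)

end Averaging

/-! ### From factorial moments to exponential tails -/

section Tail

/-- If the moments of a bounded nonnegative random variable are dominated by those of the standard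
exponential distribution, then so is its exponential moment. -/
theorem integral_exp_mul_le_of_moments_le_factorial {Ω : Type*} [MeasurableSpace Ω]
    {μ : Measure Ω} [IsProbabilityMeasure μ] {X : Ω → ℝ} (hX : Measurable X) (h0 : ∀ ω, 0 ≤ X ω)
    {C : ℝ} (hC : ∀ ω, X ω ≤ C) (hmom : ∀ k : ℕ, ∫ ω, X ω ^ k ∂μ ≤ k.factorial) {s : ℝ}
    (hs0 : 0 ≤ s) (hs1 : s < 1) : ∫ ω, Real.exp (s * X ω) ∂μ ≤ (1 - s)⁻¹ := by
  have hint (k : ℕ) : Integrable (fun ω => (s * X ω) ^ k / k.factorial) μ := by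
    refine Integrable.of_bound (C := (s * C) ^ k / k.factorial)
      (((hX.const_mul s).pow_const k).div_const _).aestronglyMeasurable (ae_of_all _ fun ω => ?_)
    have := mul_nonneg hs0 (h0 ω)
    rw [Real.norm_of_nonneg (by positivity)]
    gcongr
    exact hC ω
  have hle (k : ℕ) : ∫ ω, (s * X ω) ^ k / k.factorial ∂μ ≤ s ^ k := by
    simp_rw [mul_pow]
    rw [integral_div, integral_const_mul, div_le_iff₀ (by positivity)]
    exact mul_le_mul_of_nonneg_left (hmom k) (by positivity)
  have hnorm (k : ℕ) : ∫ ω, ‖(s * X ω) ^ k / k.factorial‖ ∂μ =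
      ∫ ω, (s * X ω) ^ k / k.factorial ∂μ := by
    refine integral_congr_ae (ae_of_all _ fun ω => ?_)
    have := mul_nonneg hs0 (h0 ω)
    exact Real.norm_of_nonneg (by positivity)
  have hgeom := hasSum_geometric_of_lt_one hs0 hs1
  have hsum : Summable fun k : ℕ => ∫ ω, ‖(s * X ω) ^ k / k.factorial‖ ∂μ := by
    refine Summable.of_nonneg_of_le (fun k => integral_nonneg fun ω => norm_nonneg _) (fun k => ?_)
      hgeom.summable
    rw [hnorm]
    exact hle k
  have h := hasSum_integral_of_summable_integral_norm hint hsum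
  have hexp (ω : Ω) : ∑' k : ℕ, (s * X ω) ^ k / k.factorial = Real.exp (s * X ω) := by
    rw [Real.exp_eq_exp_ℝ, NormedSpace.exp_eq_tsum_div]
  simp_rw [hexp] at h
  exact hasSum_le hle h hgeom

/-- The Chernoff bound for a random variable whose moments are dominated by those of the standard
exponential distribution. -/
theorem measureReal_le_exp_of_moments_le_factorial {Ω : Type*} [MeasurableSpace Ω]
    {μ : Measure Ω} [IsProbabilityMeasure μ] {X : Ω → ℝ} (hX : Measurable X) (h0 : ∀ ω, 0 ≤ X ω)
    {C : ℝ} (hC : ∀ ω, X ω ≤ C) (hmom : ∀ k : ℕ, ∫ ω, X ω ^ k ∂μ ≤ k.factorial) (t : ℝ) :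
    μ.real {ω | t ≤ X ω} ≤ Real.exp (-(1 - 1 / (2 * Real.exp 1)) * t + 2) := by
  have he : 2 ≤ Real.exp 1 := by linarith [Real.add_one_le_exp (1 : ℝ)]
  have hinv : 1 / (2 * Real.exp 1) ≤ 1 := by
    rw [div_le_one (by positivity)]
    linarith
  have hpos : 0 < 1 / (2 * Real.exp 1) := by positivity
  -- With this s the bound (1 - s)⁻¹ equals 2e, which is at most e²; this is the `+ 2` in the
  -- exponent.
  set s := 1 - 1 / (2 * Real.exp 1) with hs
  have hs0 : 0 ≤ s := by linarith
  have hint : Integrable (fun ω => Real.exp (s * X ω)) μ := by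
    refine Integrable.of_bound (C := Real.exp (s * C))
      (hX.const_mul s).exp.aestronglyMeasurable (ae_of_all _ fun ω => ?_)
    rw [Real.norm_of_nonneg (Real.exp_pos _).le]
    gcongr
    exact hC ω
  have hmgf := integral_exp_mul_le_of_moments_le_factorial hX h0 hC hmom hs0 (by linarith)
  have h2 : (1 - s)⁻¹ ≤ Real.exp 2 := by
    have h3 : (1 - s)⁻¹ = 2 * Real.exp 1 := by rw [hs]; simp
    have h4 : Real.exp 2 = Real.exp 1 * Real.exp 1 := by rw [← Real.exp_add]; norm_num
    rw [h3, h4]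
    gcongr
  calc μ.real {ω | t ≤ X ω} ≤ Real.exp (-s * t) * ProbabilityTheory.mgf X μ s :=
        ProbabilityTheory.measure_ge_le_exp_mul_mgf t hs0 hint
    _ ≤ Real.exp (-s * t) * Real.exp 2 := by
        gcongr
        exact hmgf.trans h2
    _ = Real.exp (-s * t + 2) := (Real.exp_add _ _).symm

end Tail

open Matrix

namespace Matrix

/-! ### Tensor powers, symmetrisation and polarisation -/

section TensorProduct

variable {κ n : Type*} [Fintype κ] [DecidableEq κ]

/-- The tensor product of a family of square matrices, as a multilinear map. -/
noncomputable def piTensor (κ n : Type*) [Fintype κ] [DecidableEq κ] :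
    MultilinearMap ℂ (fun _ : κ => Matrix n n ℂ) (Matrix (κ → n) (κ → n) ℂ) where
  toFun X := of fun f g => ∏ j, X j (f j) (g j)
  map_update_add' {inst} X i A B := by
    cases Subsingleton.elim inst (inferInstance : DecidableEq κ)
    ext f g
    simp only [of_apply, add_apply]
    rw [← Finset.mul_prod_erase _ _ (Finset.mem_univ i),
      ← Finset.mul_prod_erase _ (fun j => Function.update X i A j (f j) (g j)) (Finset.mem_univ i),
      ← Finset.mul_prod_erase _ (fun j => Function.update X i B j (f j) (g j)) (Finset.mem_univ i)]
    simp only [Function.update_self, add_apply, add_mul]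
    congr 2 <;> refine Finset.prod_congr rfl fun j hj => ?_ <;>
      simp [Function.update_of_ne (Finset.ne_of_mem_erase hj)]
  map_update_smul' {inst} X i c A := by
    cases Subsingleton.elim inst (inferInstance : DecidableEq κ)
    ext f g
    simp only [of_apply, smul_apply]
    rw [← Finset.mul_prod_erase _ _ (Finset.mem_univ i),
      ← Finset.mul_prod_erase _ (fun j => Function.update X i A j (f j) (g j)) (Finset.mem_univ i)]
    simp only [Function.update_self, smul_apply, smul_eq_mul, mul_assoc]
    congr 2
    refine Finset.prod_congr rfl fun j hj => ?_
    simp [Function.update_of_ne (Finset.ne_of_mem_erase hj)]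

theorem piTensor_apply (X : κ → Matrix n n ℂ) (f g : κ → n) :
    piTensor κ n X f g = ∏ j, X j (f j) (g j) := rfl

/-- The symmetrised tensor product of a family of square matrices. -/
noncomputable def symTensor (κ n : Type*) [Fintype κ] [DecidableEq κ] :
    MultilinearMap ℂ (fun _ : κ => Matrix n n ℂ) (Matrix (κ → n) (κ → n) ℂ) :=
  ∑ σ : Equiv.Perm κ, (piTensor κ n).domDomCongr σ

theorem symTensor_apply (X : κ → Matrix n n ℂ) :
    symTensor κ n X = ∑ σ : Equiv.Perm κ, piTensor κ n fun i => X (σ i) := by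
  simp [symTensor]

/-- The inclusion-exclusion coefficient that detects bijections. -/
theorem sum_prod_indicator_comp (c : κ → κ) :
    ∑ s : κ → Bool, (∏ i, if s i then (1 : ℂ) else -1) * ∏ j, (if s (c j) then (1 : ℂ) else 0) =
      if Function.Bijective c then 1 else 0 := by
  have h1 (s : κ → Bool) : ∏ j, (if s (c j) then (1 : ℂ) else 0) =
      ∏ i, (if s i then (1 : ℂ) else 0) ^ (Finset.univ.filter fun j => c j = i).card := by
    rw [← Finset.prod_fiberwise Finset.univ c]
    refine Finset.prod_congr rfl fun i _ => ?_
    rw [← Finset.prod_const]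
    exact Finset.prod_congr rfl fun j hj => by rw [(Finset.mem_filter.mp hj).2]
  simp_rw [h1, ← Finset.prod_mul_distrib]
  -- The sum over s factorises: a point i whose fibre has m elements contributes 1 - 0^m, which
  -- vanishes exactly when c misses i.
  rw [← Fintype.prod_sum (fun i (b : Bool) => (if b then (1 : ℂ) else -1) *
    (if b then (1 : ℂ) else 0) ^ (Finset.univ.filter fun j => c j = i).card)]
  simp only [Fintype.univ_bool, Finset.mem_singleton, Bool.true_eq_false, not_false_eq_true,
    Finset.sum_insert, Finset.sum_singleton, if_true, one_pow, mul_one, Bool.false_eq_true, if_false]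
  split_ifs with hc
  · refine Finset.prod_eq_one fun i _ => ?_
    obtain ⟨j, hj⟩ := hc.2 i
    have : (Finset.univ.filter fun j => c j = i).card ≠ 0 :=
      Finset.card_ne_zero_of_mem (Finset.mem_filter.mpr ⟨Finset.mem_univ j, hj⟩)
    simp [zero_pow this]
  · have hs : ¬ Function.Surjective c := fun h => hc (Finite.surjective_iff_bijective.mp h)
    simp only [Function.Surjective, not_forall, not_exists] at hs
    obtain ⟨i, hi⟩ := hs
    refine Finset.prod_eq_zero (Finset.mem_univ i) ?_
    simp [hi]

variable [Fintype n] [DecidableEq n]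

/-- The tensor power of a square matrix, as a monoid homomorphism. -/
noncomputable def tensorPow (κ n : Type*) [Fintype κ] [DecidableEq κ] [Fintype n] [DecidableEq n] :
    Matrix n n ℂ →* Matrix (κ → n) (κ → n) ℂ where
  toFun A := piTensor κ n fun _ => A
  map_one' := by
    ext f g
    simp only [piTensor_apply, one_apply]
    by_cases h : f = g
    · simp [h]
    · obtain ⟨j, hj⟩ := Function.ne_iff.mp h
      rw [if_neg h]
      exact Finset.prod_eq_zero (Finset.mem_univ j) (if_neg hj)
  map_mul' A B := by
    ext f g
    simp only [piTensor_apply, mul_apply, ← Finset.prod_mul_distrib]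
    exact Fintype.prod_sum _

theorem tensorPow_apply (A : Matrix n n ℂ) (f g : κ → n) :
    tensorPow κ n A f g = ∏ j, A (f j) (g j) := rfl

theorem tensorPow_eq_piTensor (A : Matrix n n ℂ) :
    tensorPow κ n A = piTensor κ n fun _ => A := rfl

theorem trace_tensorPow (A : Matrix n n ℂ) :
    (tensorPow κ n A).trace = A.trace ^ Fintype.card κ := by
  simp only [trace, diag, tensorPow_apply]
  rw [← Finset.card_univ, ← Finset.prod_const, Fintype.prod_sum]

theorem tensorPow_diagonal (D : n → ℂ) :
    tensorPow κ n (diagonal D) = diagonal fun f => ∏ j, D (f j) := by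
  ext f g
  rw [tensorPow_apply, diagonal_apply]
  by_cases h : f = g
  · simp [h]
  · obtain ⟨j, hj⟩ := Function.ne_iff.mp h
    rw [if_neg h]
    exact Finset.prod_eq_zero (Finset.mem_univ j) (diagonal_apply_ne _ hj)

/-- Polarisation: the symmetrised tensor product as a combination of tensor powers. -/
theorem symTensor_eq_sum_tensorPow (X : κ → Matrix n n ℂ) :
    symTensor κ n X = ∑ s : κ → Bool, (∏ i, if s i then (1 : ℂ) else -1) •
      tensorPow κ n (∑ i, if s i then X i else 0) := by
  have hrw (s : κ → Bool) : (fun _ : κ => ∑ i, if s i then X i else 0) =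
      fun _ : κ => ∑ i, (if s i then (1 : ℂ) else 0) • X i := by
    simp only [ite_smul, one_smul, zero_smul]
  have hexp (s : κ → Bool) : tensorPow κ n (∑ i, if s i then X i else 0) =
      ∑ c : κ → κ, (∏ j, if s (c j) then (1 : ℂ) else 0) • piTensor κ n fun j => X (c j) := by
    rw [tensorPow_eq_piTensor, hrw, MultilinearMap.map_sum]
    exact Finset.sum_congr rfl fun c _ =>
      (piTensor κ n).map_smul_univ (fun j => if s (c j) then (1 : ℂ) else 0) fun j => X (c j)
  simp_rw [hexp, Finset.smul_sum, smul_smul]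
  rw [Finset.sum_comm]
  simp_rw [← Finset.sum_smul, sum_prod_indicator_comp, ite_smul, zero_smul, one_smul]
  rw [symTensor_apply, ← Finset.sum_filter]
  refine Finset.sum_bij (fun σ _ => ⇑σ) (fun σ _ => by simp)
    (fun σ _ τ _ h => DFunLike.coe_injective h) (fun c hc => ?_) (fun σ _ => rfl)
  exact ⟨Equiv.ofBijective c (Finset.mem_filter.mp hc).2, Finset.mem_univ _, rfl⟩

/-- A matrix invariant under simultaneous permutations of the tensor factors is a combination of
symmetrised tensor products of matrix units. -/
theorem factorial_smul_eq_sum_symTensor (B : Matrix (κ → n) (κ → n) ℂ)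
    (hB : ∀ (σ : Equiv.Perm κ) f g, B (f ∘ σ) (g ∘ σ) = B f g) :
    ((Fintype.card κ).factorial : ℂ) • B =
      ∑ f, ∑ g, B f g • symTensor κ n fun j => single (f j) (g j) (1 : ℂ) := by
  have hs (f g : κ → n) (σ : Equiv.Perm κ) :
      (piTensor κ n fun j => single (f (σ j)) (g (σ j)) (1 : ℂ)) =
        single (f ∘ σ) (g ∘ σ) 1 := by
    ext a b
    simp only [piTensor_apply, single_apply]
    by_cases h : f ∘ σ = a ∧ g ∘ σ = b
    · obtain ⟨rfl, rfl⟩ := h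
      simp
    · rw [if_neg h]
      have : ∃ j, ¬ (f (σ j) = a j ∧ g (σ j) = b j) := by
        by_contra! hc
        exact h ⟨funext fun j => (hc j).1, funext fun j => (hc j).2⟩
      obtain ⟨j, hj⟩ := this
      exact Finset.prod_eq_zero (Finset.mem_univ j) (if_neg hj)
  -- Reindexing f and g by σ leaves the coefficients of B unchanged, so each of the k! permutations
  -- reproduces B.
  have hσ (σ : Equiv.Perm κ) :
      ∑ f, ∑ g, B f g • single (f ∘ σ) (g ∘ σ) (1 : ℂ) = B := by
    have h1 : ∑ f, ∑ g, B f g • single (f ∘ σ) (g ∘ σ) (1 : ℂ) =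
        ∑ f, ∑ g, B f g • single f g (1 : ℂ) := by
      refine Fintype.sum_equiv (σ.symm.arrowCongr (Equiv.refl n)) _ _ fun f => ?_
      refine Fintype.sum_equiv (σ.symm.arrowCongr (Equiv.refl n)) _ _ fun g => ?_
      have h2 (f : κ → n) : (σ.symm.arrowCongr (Equiv.refl n)) f = f ∘ σ := by
        funext i; simp [Equiv.arrowCongr_apply]
      rw [h2, h2, hB]
    rw [h1]
    conv_rhs => rw [matrix_eq_sum_single B]
    simp [smul_single]
  simp_rw [symTensor_apply, hs, Finset.smul_sum]
  calc ((Fintype.card κ).factorial : ℂ) • B = ∑ σ : Equiv.Perm κ, B := by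
        rw [Finset.sum_const, Finset.card_univ, Fintype.card_perm, Nat.cast_smul_eq_nsmul]
    _ = ∑ σ : Equiv.Perm κ, ∑ f, ∑ g, B f g • single (f ∘ σ) (g ∘ σ) (1 : ℂ) := by
        simp_rw [hσ]
    _ = _ := by
        rw [Finset.sum_comm]
        refine Finset.sum_congr rfl fun f _ => ?_
        rw [Finset.sum_comm]

end TensorProduct

end Matrix

namespace Matrix

/-! ### From unitary tensor powers to all permutation-invariant matrices -/

section Commutant

variable {κ n : Type*} [Fintype κ] [Fintype n] [DecidableEq n]

theorem prod_comp_eq_prod_pow_card (D : n → ℂ) (f : κ → n) :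
    ∏ j, D (f j) = ∏ a, D a ^ (Finset.univ.filter fun j => f j = a).card := by
  rw [← Finset.prod_fiberwise Finset.univ f]
  refine Finset.prod_congr rfl fun a _ => ?_
  rw [← Finset.prod_const]
  exact Finset.prod_congr rfl fun j hj => by rw [(Finset.mem_filter.mp hj).2]

variable [DecidableEq κ] {T : Matrix (κ → n) (κ → n) ℂ}

/-- A matrix in the commutant of the tensor powers of the unitary group preserves weights. -/
theorem card_fiber_eq_of_commute_unitary
    (hT : ∀ U : unitaryGroup n ℂ, Commute T (tensorPow κ n (U : Matrix n n ℂ)))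
    {f g : κ → n} (hfg : T f g ≠ 0) (a : n) :
    (Finset.univ.filter fun j => f j = a).card = (Finset.univ.filter fun j => g j = a).card := by
  -- Fibre sizes are at most `card κ`, hence below N, so powers of a primitive N-th root of unity
  -- separate them.
  set N := Fintype.card κ + 1
  have hζ := Complex.isPrimitiveRoot_exp N (Nat.succ_ne_zero _)
  set ζ := Complex.exp (2 * Real.pi * Complex.I / N)
  let D : n → ℂ := fun b => if b = a then ζ else 1
  have hD (b : n) : star (D b) * D b = 1 := by
    have h1 : ‖D b‖ = 1 := by
      simp only [D]
      split_ifs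
      · exact hζ.norm'_eq_one (Nat.succ_ne_zero _)
      · simp
    rw [Complex.star_def, ← Complex.normSq_eq_conj_mul_self, Complex.normSq_eq_norm_sq, h1]
    simp
  have hU : diagonal D ∈ unitaryGroup n ℂ := by
    rw [mem_unitaryGroup_iff', star_eq_conjTranspose, diagonal_conjTranspose, diagonal_mul_diagonal,
      ← diagonal_one]
    congr 1
    funext b
    exact hD b
  have hc := congr_fun (congr_fun (hT ⟨_, hU⟩).eq f) g
  simp only [tensorPow_diagonal, mul_diagonal, diagonal_mul] at hc
  rw [mul_comm, mul_left_inj' hfg] at hc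
  have hw (h : κ → n) : ∏ j, D (h j) = ζ ^ (Finset.univ.filter fun j => h j = a).card := by
    simp only [D]
    rw [← Finset.prod_filter, Finset.prod_const]
  rw [hw, hw] at hc
  have hlt (h : κ → n) : (Finset.univ.filter fun j => h j = a).card < N :=
    Nat.lt_succ_of_le (Finset.card_le_univ _)
  exact (hζ.pow_inj (hlt g) (hlt f) hc).symm

/-- The diagonal entry at f depends only on the fibre sizes of f, and nonzero entries of T join
indices with equal fibre sizes, so D need not be unitary. -/
theorem commute_tensorPow_diagonal
    (hT : ∀ U : unitaryGroup n ℂ, Commute T (tensorPow κ n (U : Matrix n n ℂ)))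
    (D : n → ℂ) : Commute T (tensorPow κ n (diagonal D)) := by
  ext f g
  rw [tensorPow_diagonal, mul_diagonal, diagonal_mul, mul_comm]
  by_cases hfg : T f g = 0
  · simp [hfg]
  · simp_rw [prod_comp_eq_prod_pow_card D, card_fiber_eq_of_commute_unitary hT hfg]

/-- Diagonalise H by a unitary: T commutes with the tensor power of each of the three factors. -/
theorem commute_tensorPow_of_isHermitian
    (hT : ∀ U : unitaryGroup n ℂ, Commute T (tensorPow κ n (U : Matrix n n ℂ)))
    {H : Matrix n n ℂ} (hH : H.IsHermitian) :
    Commute T (tensorPow κ n H) := by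
  rw [hH.spectral_theorem, Unitary.conjStarAlgAut_apply, map_mul, map_mul]
  refine ((hT _).mul_right (commute_tensorPow_diagonal hT _)).mul_right ?_
  exact hT (star hH.eigenvectorUnitary)

/-- Polarisation only involves tensor powers of partial sums of the H i, which are again Hermitian.
-/
theorem commute_symTensor_of_isHermitian
    (hT : ∀ U : unitaryGroup n ℂ, Commute T (tensorPow κ n (U : Matrix n n ℂ)))
    {H : κ → Matrix n n ℂ} (hH : ∀ i, (H i).IsHermitian) :
    Commute T (symTensor κ n H) := by
  rw [symTensor_eq_sum_tensorPow]
  refine Commute.sum_right _ _ _ fun s _ => Commute.smul_right ?_ _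
  refine commute_tensorPow_of_isHermitian hT ?_
  rw [IsHermitian, conjTranspose_sum]
  refine Finset.sum_congr rfl fun i _ => ?_
  split_ifs
  · exact hH i
  · exact conjTranspose_zero

/-- Split each matrix into real and imaginary parts and expand multilinearly. -/
theorem commute_symTensor
    (hT : ∀ U : unitaryGroup n ℂ, Commute T (tensorPow κ n (U : Matrix n n ℂ)))
    (X : κ → Matrix n n ℂ) : Commute T (symTensor κ n X) := by
  have hX : X = (fun i => (realPart (X i) : Matrix n n ℂ)) +
      fun i => Complex.I • (imaginaryPart (X i) : Matrix n n ℂ) := by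
    funext i
    exact (realPart_add_I_smul_imaginaryPart (X i)).symm
  rw [hX, MultilinearMap.map_add_univ]
  refine Commute.sum_right _ _ _ fun s _ => ?_
  have hs : s.piecewise (fun i => (realPart (X i) : Matrix n n ℂ))
      (fun i => Complex.I • (imaginaryPart (X i) : Matrix n n ℂ)) =
      fun i => (if i ∈ s then (1 : ℂ) else Complex.I) •
        (if i ∈ s then (realPart (X i) : Matrix n n ℂ) else imaginaryPart (X i)) := by
    funext i
    by_cases hi : i ∈ s <;> simp [hi]
  rw [hs, MultilinearMap.map_smul_univ]
  refine Commute.smul_right (commute_symTensor_of_isHermitian hT fun i => ?_) _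
  split_ifs
  · exact (realPart (X i)).2
  · exact (imaginaryPart (X i)).2

theorem commute_of_perm_invariant
    (hT : ∀ U : unitaryGroup n ℂ, Commute T (tensorPow κ n (U : Matrix n n ℂ)))
    {B : Matrix (κ → n) (κ → n) ℂ}
    (hB : ∀ (σ : Equiv.Perm κ) f g, B (f ∘ σ) (g ∘ σ) = B f g) : Commute T B := by
  have h : Commute T (((Fintype.card κ).factorial : ℂ) • B) := by
    rw [factorial_smul_eq_sum_symTensor B hB]
    exact Commute.sum_right _ _ _ fun f _ => Commute.sum_right _ _ _ fun g _ =>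
      Commute.smul_right (commute_symTensor hT _) _
  exact (Commute.smul_right_iff₀ (Nat.cast_ne_zero.mpr (Nat.factorial_ne_zero _))).mp h

end Commutant

/-! ### Schur–Weyl duality -/

section SchurWeyl

/-- The representation of the permutations of the factors on tensors. -/
def permTensorRep (κ n : Type*) : Representation ℂ (Equiv.Perm κ) ((κ → n) → ℂ) where
  toFun σ := LinearMap.funLeft ℂ ℂ fun f => f ∘ σ
  map_one' := rfl
  map_mul' _ _ := rfl

theorem permTensorRep_apply {κ n : Type*} (σ : Equiv.Perm κ) (v : (κ → n) → ℂ) (f : κ → n) :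
    permTensorRep κ n σ v f = v (f ∘ σ) := rfl

variable {κ n : Type*} [Fintype κ] [DecidableEq κ] [Fintype n] [DecidableEq n]

/-- The matrix by which a permutation acts on tensors. -/
def permTensor (n : Type*) [DecidableEq n] (σ : Equiv.Perm κ) : Matrix (κ → n) (κ → n) ℂ :=
  of fun f g => if f ∘ σ = g then 1 else 0

theorem toMatrix'_permTensorRep (σ : Equiv.Perm κ) :
    LinearMap.toMatrix' (permTensorRep κ n σ) = permTensor n σ := by
  ext f g
  simp [LinearMap.toMatrix'_apply, permTensorRep_apply, permTensor, Pi.single_apply]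

theorem toMatrix'_asAlgebraHom_mem_span (r : MonoidAlgebra ℂ (Equiv.Perm κ)) :
    LinearMap.toMatrix' ((permTensorRep κ n).asAlgebraHom r) ∈
      Submodule.span ℂ (Set.range (permTensor (κ := κ) n)) := by
  rw [Representation.asAlgebraHom_def, MonoidAlgebra.lift_apply, Finsupp.sum, map_sum]
  refine Submodule.sum_mem _ fun σ _ => ?_
  rw [map_smul, toMatrix'_permTensorRep]
  exact Submodule.smul_mem _ _ (Submodule.subset_span ⟨σ, rfl⟩)

/-- **Schur–Weyl duality**: the commutant of the tensor powers of the unitary group is spanned by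
the permutations of the tensor factors. -/
theorem mem_span_permTensor_of_commute {T : Matrix (κ → n) (κ → n) ℂ}
    (hT : ∀ U : unitaryGroup n ℂ, Commute T (tensorPow κ n (U : Matrix n n ℂ))) :
    T ∈ Submodule.span ℂ (Set.range (permTensor (κ := κ) n)) := by
  classical
  let ρ := permTensorRep κ n
  let M := ρ.asModule
  -- T viewed in the double commutant: its linearity over the endomorphisms φ holds because the
  -- matrix of φ is permutation-invariant.
  let F : Module.End (Module.End (MonoidAlgebra ℂ (Equiv.Perm κ)) M) M :=
    { toFun := fun m => ρ.asModuleEquiv.symm (T.mulVec (ρ.asModuleEquiv m))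
      map_add' := fun m m' => by rw [map_add, mulVec_add, map_add]
      map_smul' := fun φ m => by
        let ψ : ((κ → n) → ℂ) →ₗ[ℂ] ((κ → n) → ℂ) :=
          ρ.asModuleEquiv.toLinearMap ∘ₗ φ.restrictScalars ℂ ∘ₗ ρ.asModuleEquiv.symm.toLinearMap
        have hψ (σ : Equiv.Perm κ) (v : (κ → n) → ℂ) : ψ (ρ σ v) = ρ σ (ψ v) := by
          simp only [ψ, LinearMap.comp_apply, LinearEquiv.coe_coe, LinearMap.restrictScalars_apply]
          rw [Representation.asModuleEquiv_symm_map_rho, map_smul,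
            Representation.asModuleEquiv_map_smul, Representation.asAlgebraHom_of]
        have hB (σ : Equiv.Perm κ) (f g : κ → n) :
            LinearMap.toMatrix' ψ (f ∘ σ) (g ∘ σ) = LinearMap.toMatrix' ψ f g := by
          have h1 : ρ σ (Pi.single (g ∘ σ) 1) = Pi.single g (1 : ℂ) := by
            funext h
            simp only [ρ, permTensorRep_apply, Pi.single_apply]
            exact if_congr (σ.surjective.injective_comp_right.eq_iff) rfl rfl
          rw [LinearMap.toMatrix'_apply, LinearMap.toMatrix'_apply, ← h1, hψ]
          rfl
        have hc := commute_of_perm_invariant hT hB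
        have h2 (v : (κ → n) → ℂ) : T.mulVec (ψ v) = ψ (T.mulVec v) := by
          rw [← LinearMap.toMatrix'_mulVec ψ v, ← LinearMap.toMatrix'_mulVec ψ (T.mulVec v),
            mulVec_mulVec, mulVec_mulVec, hc.eq]
        simpa [ψ] using congrArg ρ.asModuleEquiv.symm (h2 (ρ.asModuleEquiv m)) }
  -- The module is semisimple (Maschke), so some r in the group algebra agrees with T on the finite
  -- standard basis, hence everywhere.
  obtain ⟨r, hr⟩ := jacobson_density F
    (Finset.univ.image fun g : κ → n => ρ.asModuleEquiv.symm (Pi.single g 1))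
  have hTr : T = LinearMap.toMatrix' (ρ.asAlgebraHom r) := by
    ext f g
    have h3 := hr _ (Finset.mem_image_of_mem _ (Finset.mem_univ g))
    have h4 := congr_fun (congrArg ρ.asModuleEquiv h3) f
    rw [Representation.asModuleEquiv_map_smul] at h4
    simpa [F, LinearMap.toMatrix'_apply] using h4
  rw [hTr]
  exact toMatrix'_asAlgebraHom_mem_span r

theorem permTensor_commute_tensorPow (σ : Equiv.Perm κ) (A : Matrix n n ℂ) :
    Commute (permTensor n σ) (tensorPow κ n A) := by
  ext f g
  have h (h : κ → n) : h ∘ σ = g ↔ h = g ∘ σ.symm := by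
    constructor
    · rintro rfl
      funext j
      simp
    · rintro rfl
      funext j
      simp
  simp only [mul_apply, permTensor, of_apply, ite_mul, one_mul, zero_mul, mul_ite, mul_one,
    mul_zero, h, Finset.sum_ite_eq, Finset.sum_ite_eq', Finset.mem_univ, if_true]
  simp only [tensorPow_apply]
  exact Fintype.prod_equiv σ _ _ fun j => by simp

/-- For an injective e the words e ∘ τ are distinct, so the entry at (e, e ∘ σ) isolates the
coefficient of σ. -/
theorem linearIndependent_permTensor (h : Fintype.card κ ≤ Fintype.card n) :
    LinearIndependent ℂ (permTensor (κ := κ) n) := by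
  obtain ⟨e⟩ := Function.Embedding.nonempty_of_card_le h
  rw [Fintype.linearIndependent_iff]
  intro c hc σ
  have h1 := congr_fun (congr_fun hc e) (e ∘ σ)
  have h2 (τ : Equiv.Perm κ) : (e ∘ τ = e ∘ σ) ↔ τ = σ :=
    e.injective.comp_left.eq_iff.trans DFunLike.coe_injective.eq_iff
  simpa [sum_apply, permTensor, h2] using h1

end SchurWeyl

end Matrix

/-! ### Trace moments as dimensions of commutants -/

section UnitaryMoments

open Matrix

attribute [local instance] Matrix.normedAddCommGroup Matrix.normedSpace

variable (κ n : Type*) [Fintype κ] [DecidableEq κ] [Fintype n] [DecidableEq n]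

/-- On the matrix unit at (a, b) the diagonal coefficient of X ↦ AXB is A a a * B b b. -/
theorem LinearMap.trace_mulLeft_comp_mulRight {m : Type*} [Fintype m] [DecidableEq m]
    (A B : Matrix m m ℂ) :
    LinearMap.trace ℂ _ (LinearMap.mulLeft ℂ A ∘ₗ LinearMap.mulRight ℂ B) = A.trace * B.trace := by
  rw [LinearMap.trace_eq_matrix_trace ℂ (Matrix.stdBasis ℂ m m), Matrix.trace,
    Fintype.sum_prod_type, Matrix.trace, Matrix.trace, Finset.sum_mul_sum]
  refine Finset.sum_congr rfl fun a _ => Finset.sum_congr rfl fun b _ => ?_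
  rw [Matrix.diag, LinearMap.toMatrix_apply, Matrix.stdBasis_eq_single]
  change (A * (Matrix.single a b (1 : ℂ) * B) : Matrix m m ℂ) a b = A a a * B b b
  simp [Matrix.mul_apply, Matrix.single_apply, ite_and]

/-- The unitary group acting by conjugation on the endomorphisms of a tensor power. -/
noncomputable def Matrix.tensorConjRep :
    Representation ℂ (unitaryGroup n ℂ) (Matrix (κ → n) (κ → n) ℂ) where
  toFun U := LinearMap.mulLeft ℂ (tensorPow κ n (U : Matrix n n ℂ)) ∘ₗ
    LinearMap.mulRight ℂ (tensorPow κ n ((U⁻¹ : unitaryGroup n ℂ) : Matrix n n ℂ))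
  map_one' := by
    ext1 T
    simp
  map_mul' U V := by
    ext1 T
    simp [Matrix.mul_assoc]

variable {κ n}

theorem Matrix.tensorConjRep_apply (U : unitaryGroup n ℂ) (T : Matrix (κ → n) (κ → n) ℂ) :
    tensorConjRep κ n U T = tensorPow κ n (U : Matrix n n ℂ) *
      (T * tensorPow κ n ((U⁻¹ : unitaryGroup n ℂ) : Matrix n n ℂ)) := rfl

theorem Matrix.mem_invariants_tensorConjRep {T : Matrix (κ → n) (κ → n) ℂ} :
    T ∈ (tensorConjRep κ n).invariants ↔
      ∀ U : unitaryGroup n ℂ, Commute T (tensorPow κ n (U : Matrix n n ℂ)) := by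
  rw [Representation.mem_invariants]
  refine forall_congr' fun U => ?_
  have h1 : tensorPow κ n ((U⁻¹ : unitaryGroup n ℂ) : Matrix n n ℂ) *
      tensorPow κ n (U : Matrix n n ℂ) = 1 := by
    rw [← map_mul, ← Submonoid.coe_mul, inv_mul_cancel, Submonoid.coe_one, map_one]
  have h2 : tensorPow κ n (U : Matrix n n ℂ) *
      tensorPow κ n ((U⁻¹ : unitaryGroup n ℂ) : Matrix n n ℂ) = 1 := by
    rw [← map_mul, ← Submonoid.coe_mul, mul_inv_cancel, Submonoid.coe_one, map_one]
  rw [tensorConjRep_apply, commute_iff_eq]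
  constructor
  · intro h
    conv_lhs => rw [← h]
    rw [Matrix.mul_assoc, Matrix.mul_assoc, h1, Matrix.mul_one]
  · intro h
    rw [← Matrix.mul_assoc, ← h, Matrix.mul_assoc, h2, Matrix.mul_one]

theorem Matrix.continuous_tensorPow_unitary :
    Continuous fun U : unitaryGroup n ℂ => tensorPow κ n (U : Matrix n n ℂ) := by
  refine continuous_matrix fun f g => ?_
  simp only [tensorPow_apply]
  exact continuous_finsetProd _ fun j _ => continuous_subtype_val.matrix_elem _ _

theorem Matrix.continuous_tensorConjRep (T : Matrix (κ → n) (κ → n) ℂ) :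
    Continuous fun U => tensorConjRep κ n U T :=
  continuous_tensorPow_unitary.matrix_mul
    (continuous_const.matrix_mul (continuous_tensorPow_unitary.comp continuous_inv))

/-- Since U⁻¹ = U*, the two trace factors are complex conjugates. -/
theorem Matrix.trace_tensorConjRep (U : unitaryGroup n ℂ) :
    LinearMap.trace ℂ _ (tensorConjRep κ n U) =
      ((‖(U : Matrix n n ℂ).trace‖ ^ (2 * Fintype.card κ) : ℝ) : ℂ) := by
  have h : ((U⁻¹ : unitaryGroup n ℂ) : Matrix n n ℂ).trace = star (U : Matrix n n ℂ).trace :=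
    trace_conjTranspose _
  refine (LinearMap.trace_mulLeft_comp_mulRight _ _).trans ?_
  rw [trace_tensorPow, trace_tensorPow, h, ← mul_pow, Complex.star_def, Complex.mul_conj,
    Complex.normSq_eq_norm_sq, pow_mul]
  push_cast
  rfl

theorem Matrix.finrank_invariants_tensorConjRep_le :
    Module.finrank ℂ (tensorConjRep κ n).invariants ≤ (Fintype.card κ).factorial := by
  rw [← Fintype.card_perm]
  refine le_trans (Submodule.finrank_mono fun T hT => ?_)
    (finrank_range_le_card (R := ℂ) (permTensor (κ := κ) n))
  exact mem_span_permTensor_of_commute (mem_invariants_tensorConjRep.mp hT)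

theorem Matrix.finrank_invariants_tensorConjRep_eq (h : Fintype.card κ ≤ Fintype.card n) :
    Module.finrank ℂ (tensorConjRep κ n).invariants = (Fintype.card κ).factorial := by
  refine le_antisymm finrank_invariants_tensorConjRep_le ?_
  rw [← Fintype.card_perm, ← finrank_span_eq_card (linearIndependent_permTensor h)]
  refine Submodule.finrank_mono (Submodule.span_le.mpr ?_)
  rintro _ ⟨σ, rfl⟩
  exact mem_invariants_tensorConjRep.mpr fun U => permTensor_commute_tensorPow σ _

theorem continuous_trace_unitary :
    Continuous fun U : unitaryGroup n ℂ => (U : Matrix n n ℂ).trace :=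
  continuous_subtype_val.matrix_trace

/-- The moments of the trace of a Haar distributed unitary matrix are dimensions of commutants. -/
theorem integral_norm_trace_pow_haarUnitary (d k : ℕ) :
    ∫ U : unitaryGroup (Fin d) ℂ, ‖(U : Matrix (Fin d) (Fin d) ℂ).trace‖ ^ (2 * k)
      ∂(haarUnitary d) = Module.finrank ℂ (tensorConjRep (Fin k) (Fin d)).invariants := by
  have h := (tensorConjRep (Fin k) (Fin d)).integral_trace_eq_finrank_invariants (haarUnitary d)
    continuous_tensorConjRep
  simp_rw [trace_tensorConjRep, Fintype.card_fin] at h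
  rw [integral_complex_ofReal] at h
  exact_mod_cast h

theorem integral_norm_trace_pow_haarUnitary_le (d k : ℕ) :
    ∫ U : unitaryGroup (Fin d) ℂ, ‖(U : Matrix (Fin d) (Fin d) ℂ).trace‖ ^ (2 * k)
      ∂(haarUnitary d) ≤ k.factorial := by
  rw [integral_norm_trace_pow_haarUnitary]
  have h := finrank_invariants_tensorConjRep_le (κ := Fin k) (n := Fin d)
  rw [Fintype.card_fin] at h
  exact_mod_cast h

end UnitaryMoments

theorem mainTheorem8 (d : ℕ) :
    (∀ k : ℕ,
      Integrable (fun U : Matrix.unitaryGroup (Fin d) ℂ =>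
        ‖Matrix.trace (U : Matrix (Fin d) (Fin d) ℂ)‖ ^ (2 * k)) (haarUnitary d) ∧
      ∫ U : Matrix.unitaryGroup (Fin d) ℂ,
        ‖Matrix.trace (U : Matrix (Fin d) (Fin d) ℂ)‖ ^ (2 * k) ∂(haarUnitary d)
          ≤ (k.factorial : ℝ) ∧
      (k ≤ d →
        ∫ U : Matrix.unitaryGroup (Fin d) ℂ,
          ‖Matrix.trace (U : Matrix (Fin d) (Fin d) ℂ)‖ ^ (2 * k) ∂(haarUnitary d)
            = (k.factorial : ℝ))) ∧
    (∀ t : ℝ, 0 ≤ t →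
      (haarUnitary d).real
        {U : Matrix.unitaryGroup (Fin d) ℂ |
          t ≤ ‖Matrix.trace (U : Matrix (Fin d) (Fin d) ℂ)‖ ^ 2}
        ≤ Real.exp (-(1 - 1 / (2 * Real.exp 1)) * t + 2)) := by
  refine ⟨fun k => ⟨(continuous_trace_unitary.norm.pow _).integrable_of_compactSpace _,
    integral_norm_trace_pow_haarUnitary_le d k, fun hk => ?_⟩, fun t _ => ?_⟩
  · rw [integral_norm_trace_pow_haarUnitary,
      Matrix.finrank_invariants_tensorConjRep_eq (by simpa using hk), Fintype.card_fin]
  · have hcont : Continuous fun U : Matrix.unitaryGroup (Fin d) ℂ =>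
        ‖Matrix.trace (U : Matrix (Fin d) (Fin d) ℂ)‖ ^ 2 := continuous_trace_unitary.norm.pow 2
    obtain ⟨C, hC⟩ := isCompact_univ.bddAbove_image hcont.continuousOn
    refine measureReal_le_exp_of_moments_le_factorial hcont.measurable (fun U => by positivity)
      (fun U => hC ⟨U, Set.mem_univ U, rfl⟩) (fun k => ?_) t
    simp_rw [← pow_mul]
    exact integral_norm_trace_pow_haarUnitary_le d k
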